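/- Let $K$ be an algebraically closed field, let $X$ be an affine variety over $K$ and let $G$ be an affine algebraic group over $K$ acting (algebraically, from the left) on $X$. Here varieties need not be irreducible, and $X$ and $G$ may more generally be any affine scheme, respectively affine group scheme, of finite type over $K$ (not necessarily reduced). For a commutative $K$-algebra $A$ write $X(A)=\operatorname{Hom}_K(\operatorname{Spec} A,X)$ and $G(A)=\operatorname{Hom}_K(\operatorname{Spec} A,G)$ for the sets of morphisms of schemes over $K$; thus $G(A)$ is a group acting on $X(A)$, functorially in $A$. For $x\in X(K)$ let $O_x=G(K)\cdot x\subseteq X(K)$ be its orbit and $\overline{O_x}$ the closure of $O_x$ in $X(K)$ for the Zariski topology. Let $\mathrm{unit}:K\to K[[t]]$, $\mathrm{inc}:K[[t]]\to K((t))$ and $\mathrm{proj}:K[[t]]\to K$, $t\mapsto 0$, be the unit map, the inclusion and the canonical projection. **Theorem.** Let $x,y\in X(K)$. Then $O_y\subseteq\overline{O_x}$ if and only if there exists $\mathcal X\in X(K[[t]])$ such that $$X(\mathrm{inc})(\mathcal X)=g\cdot X(\mathrm{inc}\circ\mathrm{unit})(x)\ \text{ in } X(K((t)))\text{ for some } g\in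 G(K((t))),\qquad X(\mathrm{proj})(\mathcal X)=y .$$ -/

import Mathlib

open CategoryTheory AlgebraicGeometry

universe u

namespace OrbitClosure

noncomputable section

/-- `Spec A`, for a commutative `K`-algebra `A`, as a scheme over `Spec K`. -/
abbrev spec (K : Type u) [Field K] (A : Type u) [CommRing A] [Algebra K A] :
    Over (Spec (CommRingCat.of K)) :=
  Over.mk (Spec.map (CommRingCat.ofHom (algebraMap K A)))

/-- The morphism `Spec B ⟶ Spec A` of schemes over `Spec K` induced by a homomorphism `A → B` of
`K`-algebras. -/
def specMap {K : Type u} [Field K] {A B : Type u} [CommRing A] [Algebra K A] [CommRing B]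
    [Algebra K B] (f : A →ₐ[K] B) : spec K B ⟶ spec K A :=
  Over.homMk (Spec.map (CommRingCat.ofHom f.toRingHom)) (by
    change Spec.map _ ≫ Spec.map _ = Spec.map _
    rw [← Spec.map_comp, ← CommRingCat.ofHom_comp]
    exact congrArg (fun φ => Spec.map (CommRingCat.ofHom φ)) f.comp_algebraMap)

/-- The set `X(A)` of `A`-points of a scheme `X` over `K`: morphisms `Spec A ⟶ X` over `Spec K`.
When `X` is a group object, or is acted on by a group object `G`, Mathlib equips `X(A)` with the
induced group structure, respectively with the induced action of `G(A)`. -/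
abbrev Points {K : Type u} [Field K] (X : Over (Spec (CommRingCat.of K)))
    (A : Type u) [CommRing A] [Algebra K A] : Type u :=
  spec K A ⟶ X

/-- The functoriality of `A ↦ X(A)`. -/
def Points.map {K : Type u} [Field K] (X : Over (Spec (CommRingCat.of K)))
    {A B : Type u} [CommRing A] [Algebra K A] [CommRing B] [Algebra K B] (f : A →ₐ[K] B)
    (x : Points X A) : Points X B :=
  specMap f ≫ x

/-- The point of the underlying space of `X` that is the image of the `K`-point `x`. -/
def Points.toPoint {K : Type u} [Field K] {X : Over (Spec (CommRingCat.of K))}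
    (x : Points X K) : X.left :=
  x.left (IsLocalRing.closedPoint K : PrimeSpectrum K)

/-- The Zariski topology on the set `X(K)` of `K`-points. -/
@[reducible]
def zariskiTopology {K : Type u} [Field K] (X : Over (Spec (CommRingCat.of K))) :
    TopologicalSpace (Points X K) :=
  TopologicalSpace.induced Points.toPoint inferInstance

/-- The inclusion `K[[t]] → K((t))`. -/
def inc (K : Type u) [Field K] : PowerSeries K →ₐ[K] LaurentSeries K where
  toRingHom := HahnSeries.ofPowerSeries ℤ K
  commutes' r := by
    change HahnSeries.ofPowerSeries ℤ K (algebraMap K (PowerSeries K) r) = _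
    rw [PowerSeries.algebraMap_apply, Algebra.algebraMap_self_apply, HahnSeries.ofPowerSeries_C,
      HahnSeries.algebraMap_apply', PowerSeries.algebraMap_apply, Algebra.algebraMap_self_apply,
      HahnSeries.ofPowerSeries_C]

/-- The unit map `K → K[[t]]`. -/
def unit (K : Type u) [Field K] : K →ₐ[K] PowerSeries K :=
  Algebra.ofId K (PowerSeries K)

/-- The projection `K[[t]] → K`, `t ↦ 0`. -/
def proj (K : Type u) [Field K] : PowerSeries K →ₐ[K] K where
  toRingHom := PowerSeries.constantCoeff
  commutes' r := by
    change PowerSeries.constantCoeff (algebraMap K (PowerSeries K) r) = _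
    simp

end

end OrbitClosure

/-! On coordinate rings the orbit map of `x` is a homomorphism `φ : R → H`, and the orbit is its
image on `K`-points. Translations are continuous and preserve the orbit, so the inclusion says only
that `y` lies in the closure of this image. What remains is a valuative criterion,
`mem_closure_image_iff_exists_powerSeries`.

Given an arc, a function vanishing on the image is nilpotent in `H`, hence zero in `K((t))`, hence
zero in `K[[t]]` and at `y`.

Conversely, some component of `Spec H` has `y` in the closure of its image, which reduces to an
injection `A → B` (`exists_specialization_of_injective`). If `y` does not lift to `B`, Chevalley
gives a nonempty `D(h)` inside the image. Noether normalization and going down lift a line of affine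
space to a curve in `Spec A` through `y` that meets `D(h)`. Its generic point lifts to `B` over a
finite extension `L` of the function field of the line. A valuation ring of `L` centred at `y` has
residue field `K` and a uniformizer; expansion in the uniformizer embeds `L` in `K((t))`
(`exists_laurentSeries_embedding`). -/

namespace OrbitClosure

/-! ### Power series expansions on valuation rings of function fields in one variable -/

/-- An element `ϖ` of a domain `V` over `K` that generates the kernel of an augmentation
`c : V → K` gives a power series expansion `V → K[[t]]`, `ϖ ↦ t`. -/
theorem exists_powerSeries_expansion {K V : Type*} [Field K] [CommRing V] [IsDomain V]
    [Algebra K V] (c : V →ₐ[K] K) (ϖ : V) (hϖ : ϖ ≠ 0) (hcϖ : c ϖ = 0)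
    (hc : ∀ v, c v = 0 → ϖ ∣ v) :
    ∃ S : V →ₐ[K] PowerSeries K, (∀ v, PowerSeries.constantCoeff (S v) = c v) ∧
      ∀ v, S v = 0 → ∀ n : ℕ, ϖ ^ n ∣ v := by
  have h (v : V) : ∃ d, v = algebraMap K V (c v) + ϖ * d := by
    obtain ⟨d, hd⟩ := hc (v - algebraMap K V (c v)) (by simp)
    exact ⟨d, by rw [← hd]; ring⟩
  choose d hd using h
  -- Constant term and quotient by `ϖ` are unique; every identity for `d` follows from this.
  have hdu (v : V) (k : K) (w : V) (e : v = algebraMap K V k + ϖ * w) : c v = k ∧ d v = w := by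
    have hk : c v = k := by rw [e]; simp [hcϖ]
    refine ⟨hk, mul_left_cancel₀ hϖ ?_⟩
    have := hd v
    rw [hk] at this
    exact add_left_cancel (this.symm.trans e)
  let S (v : V) : PowerSeries K := PowerSeries.mk fun n ↦ c (d^[n] v)
  have hS (v : V) : S v = PowerSeries.C (c v) + PowerSeries.X * S (d v) := by
    ext n
    cases n with
    | zero => simp [S]
    | succ n => simp [S, PowerSeries.coeff_succ_X_mul]
  have hd_add (v w : V) : d (v + w) = d v + d w :=
    (hdu _ (c v + c w) _ (by
      rw [map_add]; linear_combination hd v + hd w)).2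
  have hd_mul (v w : V) : d (v * w) = d v * w + algebraMap K V (c v) * d w :=
    (hdu _ (c v * c w) _ (by
      rw [map_mul]; linear_combination w * hd v + algebraMap K V (c v) * hd w)).2
  have hd_alg (k : K) : d (algebraMap K V k) = 0 := (hdu _ k 0 (by simp)).2
  have hd_zero : d 0 = 0 := by simpa using hd_alg 0
  have hit_zero (n : ℕ) : d^[n] 0 = 0 := Function.iterate_fixed hd_zero n
  have hit_add (n : ℕ) (v w : V) : d^[n] (v + w) = d^[n] v + d^[n] w := by
    induction n generalizing v w with
    | zero => rfl
    | succ n ih => simp [hd_add, ih]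
  have hS_zero : S 0 = 0 := by ext n; simp [S, hit_zero]
  have hS_add (v w : V) : S (v + w) = S v + S w := by ext n; simp [S, hit_add]
  have hS_alg (k : K) : S (algebraMap K V k) = PowerSeries.C k := by
    rw [hS, hd_alg, hS_zero]; simp
  -- The twisted Leibniz rule `hd_mul` gains one factor `X` per step, so the defect of
  -- multiplicativity is divisible by every power of `X`.
  have hit_dvd (n : ℕ) (v w : V) : PowerSeries.X ^ n ∣ S (v * w) - S v * S w := by
    induction n generalizing v w with
    | zero => simp
    | succ n ih =>
      have e : S (v * w) - S v * S w = PowerSeries.X * (S (d v * w) - S (d v) * S w) +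
          PowerSeries.X * (S (algebraMap K V (c v) * d w) - PowerSeries.C (c v) * S (d w)) := by
        rw [hS (v * w), hd_mul, hS_add, hS v]
        conv_lhs => rw [add_mul, hS w]
        conv_rhs => rw [hS w]
        rw [map_mul, map_mul]
        ring
      rw [e, pow_succ', ← hS_alg]
      exact dvd_add (mul_dvd_mul_left _ (ih _ _)) (mul_dvd_mul_left _ (ih _ _))
  have hS_mul (v w : V) : S (v * w) = S v * S w := by
    rw [← sub_eq_zero]
    ext n
    exact PowerSeries.X_pow_dvd_iff.mp (hit_dvd (n + 1) v w) n (Nat.lt_succ_self n)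
  refine ⟨{ toFun := S, map_one' := ?_, map_mul' := hS_mul, map_zero' := hS_zero,
            map_add' := hS_add, commutes' := hS_alg }, ?_, ?_⟩
  · simpa using hS_alg 1
  · intro v
    change PowerSeries.constantCoeff (S v) = _
    simp [S]
  · intro v hv n
    change S v = 0 at hv
    induction n generalizing v with
    | zero => simp
    | succ n ih =>
      have hn (n : ℕ) : c (d^[n] v) = 0 := by
        simpa [S] using congrArg (PowerSeries.coeff n) hv
      obtain ⟨w, hw⟩ := ih (d v) (by ext n; simpa [S] using hn (n + 1))
      refine ⟨w, ?_⟩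
      have := hn 0
      rw [Function.iterate_zero, id] at this
      rw [hd v, this, hw, map_zero, zero_add, pow_succ']
      ring

/-- A family in `V` that is linearly independent over `K` modulo `τ` is linearly independent over
a subring `R` in which `τ` generates the kernel of an augmentation and is separated. -/
theorem linearIndependent_of_mod {K R V ι : Type*} [Field K] [CommRing R] [Algebra K R]
    [CommRing V] [IsDomain V] [Algebra K V] [Algebra R V] [IsScalarTower K R V]
    (ε : R →ₐ[K] K) (τ : R) (hε : ∀ r, ε r = 0 → τ ∣ r)
    (hsep : ∀ r : R, (∀ n : ℕ, τ ^ n ∣ r) → r = 0) (hτ : algebraMap R V τ ≠ 0)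
    (v : ι → V) (hv : LinearIndependent K fun i ↦
      Ideal.Quotient.mk (Ideal.span {algebraMap R V τ}) (v i)) :
    LinearIndependent R v := by
  rw [linearIndependent_iff'] at hv ⊢
  intro s g hg
  -- Descent: modulo `τ` the relation forces all `ε (g i)` to vanish, and then one factor `τ`
  -- cancels.
  have key (n : ℕ) : ∀ g : ι → R, ∑ i ∈ s, g i • v i = 0 → ∀ i ∈ s, τ ^ n ∣ g i := by
    induction n with
    | zero => simp
    | succ n ih =>
      intro g hg
      have h (r : R) : ∃ d, r = algebraMap K R (ε r) + τ * d := by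
        obtain ⟨d, hd⟩ := hε (r - algebraMap K R (ε r)) (by simp)
        exact ⟨d, by rw [← hd]; ring⟩
      choose d hd using h
      have e : ∑ i ∈ s, g i • v i = ∑ i ∈ s, ε (g i) • v i +
          algebraMap R V τ * ∑ i ∈ s, d (g i) • v i := by
        rw [Finset.mul_sum, ← Finset.sum_add_distrib]
        refine Finset.sum_congr rfl fun i _ ↦ ?_
        conv_lhs => rw [hd (g i)]
        simp [Algebra.smul_def, ← IsScalarTower.algebraMap_apply]
        ring
      rw [hg] at e
      have h0 : ∀ i ∈ s, ε (g i) = 0 := by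
        refine hv s (fun i ↦ ε (g i)) ?_
        simp_rw [← Ideal.Quotient.mkₐ_eq_mk K, ← map_smul, ← map_sum]
        rw [Ideal.Quotient.mkₐ_eq_mk, Ideal.Quotient.eq_zero_iff_mem, Ideal.mem_span_singleton]
        exact ⟨-∑ i ∈ s, d (g i) • v i, by linear_combination -e⟩
      have h1 : ∑ i ∈ s, d (g i) • v i = 0 := by
        rw [Finset.sum_eq_zero fun i hi ↦ by rw [h0 i hi, zero_smul], zero_add] at e
        exact (mul_eq_zero.mp e.symm).resolve_left hτ
      intro i hi
      rw [hd (g i), h0 i hi, map_zero, zero_add, pow_succ']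
      exact mul_dvd_mul_left _ (ih _ h1 i hi)
  exact fun i hi ↦ hsep _ fun n ↦ key n g hg i hi

/-- A valuation ring `V` of a field `L` of transcendence degree one over an algebraically closed
field `K`, containing `K`, embeds into `K[[t]]`, compatibly with an embedding of `L` into
`K((t))`. -/
theorem exists_laurentSeries_embedding {K R F V L : Type u} [Field K] [IsAlgClosed K]
    [CommRing R] [Algebra K R] [Field F] [Algebra R F] [IsFractionRing R F]
    [CommRing V] [IsDomain V] [ValuationRing V] [Algebra K V] [Algebra R V] [IsScalarTower K R V]
    [Field L] [Algebra K L] [Algebra V L] [IsFractionRing V L] [IsScalarTower K V L]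
    [Algebra R L] [IsScalarTower R V L] [Algebra F L] [IsScalarTower R F L] [Module.Finite F L]
    (ε : R →ₐ[K] K) (τ : R) (hε : ∀ r, ε r = 0 → τ ∣ r)
    (hsep : ∀ r : R, (∀ n : ℕ, τ ^ n ∣ r) → r = 0) (hτ : algebraMap R V τ ≠ 0)
    (hτ' : ¬ IsUnit (algebraMap R V τ)) :
    ∃ (S : V →ₐ[K] PowerSeries K) (T : L →ₐ[K] LaurentSeries K),
      (∀ v, T (algebraMap V L v) = inc K (S v)) ∧
      ∀ v, ¬ IsUnit v → PowerSeries.constantCoeff (S v) = 0 := by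
  set t := algebraMap R V τ with ht
  have : IsDomain R := (IsFractionRing.injective R F).isDomain
  -- A `K`-basis of `V/(t)` lifts to a family independent over `R`, hence over `F` in `L`, so it is
  -- finite.
  have : Module.Finite K (V ⧸ Ideal.span {t}) := by
    let b := Module.Basis.ofVectorSpace K (V ⧸ Ideal.span {t})
    choose v hv using fun i ↦ Ideal.Quotient.mk_surjective (b i)
    have hli : LinearIndependent R v := linearIndependent_of_mod ε τ hε hsep hτ v (by
      rw [← ht]; simp only [hv]; exact b.linearIndependent)
    have hli' : LinearIndependent R fun i ↦ algebraMap V L (v i) :=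
      hli.map_injOn (IsScalarTower.toAlgHom R V L).toLinearMap
        (IsFractionRing.injective V L).injOn
    have := ((LinearIndependent.iff_fractionRing R F).mp hli').finite
    exact Module.Finite.of_basis b
  let κ := IsLocalRing.ResidueField V
  have hres : Function.Bijective (algebraMap K κ) := by
    have : Module.Finite K κ := by
      let q : (V ⧸ Ideal.span {t}) →ₐ[K] κ := Ideal.Quotient.liftₐ _
        (IsScalarTower.toAlgHom K V κ) (by
          intro a ha
          rw [Ideal.mem_span_singleton] at ha
          exact (IsLocalRing.residue_eq_zero_iff a).mpr fun h ↦ hτ' (isUnit_of_dvd_unit ha h))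
      refine Module.Finite.of_surjective q.toLinearMap fun x ↦ ?_
      obtain ⟨v, rfl⟩ := IsLocalRing.residue_surjective x
      exact ⟨Ideal.Quotient.mk _ v, rfl⟩
    exact IsAlgClosed.algebraMap_bijective_of_isIntegral
  let c : V →ₐ[K] K := (AlgEquiv.ofBijective (Algebra.ofId K κ) hres).symm.toAlgHom.comp
    (IsScalarTower.toAlgHom K V κ)
  have hc (v : V) : c v = 0 ↔ ¬ IsUnit v := by
    have : c v = (AlgEquiv.ofBijective (Algebra.ofId K κ) hres).symm (IsLocalRing.residue V v) :=
      rfl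
    rw [this, EmbeddingLike.map_eq_zero_iff, IsLocalRing.residue_eq_zero_iff]
    rfl
  have hct : c t = 0 := (hc t).mpr hτ'
  -- Finite generation suffices: a valuation ring is Bézout, so the maximal ideal is then principal.
  have hm_fg : (IsLocalRing.maximalIdeal V).FG := by
    have : IsNoetherian V (V ⧸ Ideal.span {t}) := isNoetherian_of_tower K inferInstance
    refine Submodule.fg_of_fg_map_of_fg_inf_ker (Submodule.mkQ (Ideal.span {t}))
      (IsNoetherian.noetherian _) ?_
    rw [Submodule.ker_mkQ, inf_of_le_right]
    · exact ⟨{t}, by simp⟩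
    · rw [Ideal.span_singleton_le_iff_mem]
      exact hτ'
  obtain ⟨ϖ, hϖ⟩ := IsBezout.isPrincipal_of_FG _ hm_fg
  have hϖu (v : V) : ¬ IsUnit v ↔ ϖ ∣ v := by
    rw [← Ideal.mem_span_singleton, ← Ideal.submodule_span_eq, ← hϖ]
    rfl
  have hϖ0 : ϖ ≠ 0 := by
    rintro rfl
    exact hτ (zero_dvd_iff.mp ((hϖu t).mp hτ'))
  have hcϖ : c ϖ = 0 := (hc ϖ).mpr ((hϖu ϖ).mpr dvd_rfl)
  -- Modulo `t`, `ϖ` is a root of a monic polynomial. Splitting off the power of the variable leaves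
  -- a cofactor with nonzero constant term, whose value at `ϖ` is a unit.
  have htϖ : ∃ j : ℕ, t ∣ ϖ ^ j := by
    obtain ⟨f, hf, hf'⟩ := Algebra.IsIntegral.isIntegral (R := K)
      (Ideal.Quotient.mk (Ideal.span {t}) ϖ)
    have hdvd : t ∣ Polynomial.aeval ϖ f := by
      rw [← Ideal.mem_span_singleton, ← Ideal.Quotient.eq_zero_iff_mem,
        ← Ideal.Quotient.mkₐ_eq_mk K, ← Polynomial.aeval_algHom_apply]
      exact hf'
    obtain ⟨g, hg, hg'⟩ := Polynomial.exists_eq_pow_rootMultiplicity_mul_and_not_dvd f hf.ne_zero 0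
    rw [map_zero, sub_zero] at hg hg'
    have hgu : IsUnit (Polynomial.aeval ϖ g) := by
      by_contra h
      rw [← hc, ← Polynomial.aeval_algHom_apply, hcϖ] at h
      exact hg' (Polynomial.X_dvd_iff.mpr (by
        simpa [Polynomial.coeff_zero_eq_aeval_zero] using h))
    refine ⟨f.rootMultiplicity 0, ?_⟩
    rw [hg, map_mul, map_pow, Polynomial.aeval_X] at hdvd
    exact hgu.dvd_mul_right.mp hdvd
  -- Some nonzero multiple `r • v⁻¹` is integral over `R`, hence lies in `V`, so `v ∣ r`; and `r` is
  -- a power of `τ` times a unit of `V`.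
  have hdvd (v : V) (hv : v ≠ 0) : ∃ k : ℕ, v ∣ t ^ k := by
    have hv' : algebraMap V L v ≠ 0 := by
      rwa [Ne, IsFractionRing.to_map_eq_zero_iff]
    have halg : IsAlgebraic R (algebraMap V L v)⁻¹ :=
      (IsFractionRing.isAlgebraic_iff R F L).mpr (Algebra.IsAlgebraic.isAlgebraic _)
    obtain ⟨r, hr, hr'⟩ := halg.exists_integral_multiple
    obtain ⟨w, hw⟩ := IsIntegrallyClosed.isIntegral_iff.mp (hr'.tower_top (A := V))
    have hvr : v ∣ algebraMap R V r := by
      refine ⟨w, IsFractionRing.injective V L ?_⟩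
      rw [map_mul, hw, Algebra.smul_def, ← IsScalarTower.algebraMap_apply]
      field_simp
    have hfin : FiniteMultiplicity τ r := by
      by_contra h
      refine hr (hsep r fun n ↦ ?_)
      rw [FiniteMultiplicity.not_iff_forall] at h
      exact h n
    obtain ⟨s, hs, hs'⟩ := hfin.exists_eq_pow_mul_and_not_dvd
    have hsu : IsUnit (algebraMap R V s) := by
      by_contra h
      obtain ⟨d, hd⟩ := hε (s - algebraMap K R (ε s)) (by simp)
      rw [← hc, eq_add_of_sub_eq' hd, map_add, ← IsScalarTower.algebraMap_apply, map_mul,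
        map_add, map_mul, ← ht, hct, zero_mul, add_zero, AlgHom.commutes] at h
      exact hs' (hε s h)
    refine ⟨multiplicity τ r, ?_⟩
    rw [hs, map_mul, map_pow] at hvr
    exact hsu.dvd_mul_right.mp hvr
  obtain ⟨S, hSc, hS0⟩ := exists_powerSeries_expansion c ϖ hϖ0 hcϖ fun v hv ↦
    (hϖu v).mp ((hc v).mp hv)
  have hSinj : Function.Injective S := by
    rw [injective_iff_map_eq_zero]
    intro v hv
    by_contra hv0
    obtain ⟨k, hk⟩ := hdvd v hv0
    obtain ⟨j, hj⟩ := htϖ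
    have h1 : ϖ ^ (j * k + 1) ∣ ϖ ^ (j * k) :=
      ((hS0 v hv _).trans hk).trans (by rw [pow_mul]; exact pow_dvd_pow_of_dvd hj k)
    have h2 : ϖ ∣ 1 := by
      rw [pow_succ] at h1
      exact (mul_dvd_mul_iff_left (pow_ne_zero (j * k) hϖ0)).mp (by simpa using h1)
    exact (hϖu 1).mpr h2 isUnit_one
  have hinj : Function.Injective ((inc K).comp S) :=
    HahnSeries.ofPowerSeries_injective.comp hSinj
  refine ⟨S, IsFractionRing.liftAlgHom (K := L) hinj, fun v ↦ ?_, fun v hv ↦ ?_⟩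
  · rw [IsFractionRing.liftAlgHom_apply, IsFractionRing.lift_algebraMap]
    rfl
  · rw [hSc, hc]; exact hv

/-- Let `ψ : A → L` be a homomorphism to a function field in one variable and `y : A → K` a point
in the closure of its image. Then `L` embeds into `K((t))` such that the image of `A` lies in
`K[[t]]` and specializes to `y` at `t = 0`. -/
theorem exists_laurentSeries_specialization {K R F L A : Type u} [Field K] [IsAlgClosed K]
    [CommRing R] [Algebra K R] [Field F] [Algebra R F] [IsFractionRing R F]
    [Field L] [Algebra K L] [Algebra R L] [IsScalarTower K R L] [Algebra F L]
    [IsScalarTower R F L] [Module.Finite F L] [CommRing A] [Algebra K A]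
    (ε : R →ₐ[K] K) (τ : R) (hτ : τ ≠ 0) (hε : ∀ r, ε r = 0 → τ ∣ r)
    (hsep : ∀ r : R, (∀ n : ℕ, τ ^ n ∣ r) → r = 0)
    (ψ : A →ₐ[K] L) (y : A →ₐ[K] K) (hψy : ∀ a, ψ a = 0 → y a = 0)
    (hR : ∀ r, ∃ a, ψ a = algebraMap R L r) (hyτ : ∃ a, y a = 0 ∧ ψ a = algebraMap R L τ) :
    ∃ (α : A →ₐ[K] PowerSeries K) (T : L →ₐ[K] LaurentSeries K),
      (∀ a, inc K (α a) = T (ψ a)) ∧ ∀ a, PowerSeries.constantCoeff (α a) = y a := by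
  let f : A →+* L := ψ
  -- The valuation ring contains `ψ(A)` and is centred at `y`; the ideal is proper because `ker ψ ⊆
  -- ker y`.
  obtain ⟨V, hV, hVm⟩ := Ideal.image_subset_nonunits_valuationSubring (K := L)
    ((RingHom.ker y).map f.rangeRestrict) (by
      rw [Ne, Ideal.map_eq_top_iff_of_ker_le _ (fun a ha ↦ ?_)
        (RingHom.isIntegral_of_surjective _ f.rangeRestrict_surjective)]
      · exact RingHom.ker_ne_top y
      · exact hψy a (by simpa [Subtype.ext_iff, f] using ha))
  have hAV (a : A) : ψ a ∈ V := hV ⟨a, rfl⟩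
  have hRV (r : R) : algebraMap R L r ∈ V := by
    obtain ⟨a, ha⟩ := hR r
    exact ha ▸ hAV a
  have hKV (k : K) : algebraMap K L k ∈ V := by
    rw [IsScalarTower.algebraMap_apply K R L]
    exact hRV _
  let _ : Algebra K V := ((algebraMap K L).codRestrict V.toSubring hKV).toAlgebra
  let _ : Algebra R V := ((algebraMap R L).codRestrict V.toSubring hRV).toAlgebra
  have : IsScalarTower K R V := .of_algebraMap_eq fun k ↦
    Subtype.ext (IsScalarTower.algebraMap_apply K R L k)
  have : IsScalarTower K V L := .of_algebraMap_eq fun _ ↦ rfl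
  have : IsScalarTower R V L := .of_algebraMap_eq fun _ ↦ rfl
  let ψV : A →ₐ[K] V :=
    { (f.codRestrict V.toSubring hAV) with
      commutes' := fun k ↦ Subtype.ext (ψ.commutes k) }
  have hm (a : A) (ha : y a = 0) : ¬ IsUnit (ψV a) := by
    have h : ψ a ∈ V.nonunits :=
      hVm ⟨f.rangeRestrict a, Ideal.mem_map_of_mem _ ha, rfl⟩
    exact (V.coe_mem_nonunits_iff (a := ψV a)).mp h
  have hinjR : Function.Injective (algebraMap R L) := by
    rw [IsScalarTower.algebraMap_eq R F L]
    exact (algebraMap F L).injective.comp (IsFractionRing.injective R F)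
  obtain ⟨S, T, hST, hS⟩ := exists_laurentSeries_embedding (F := F) (V := V) (L := L) ε τ hε
    hsep (fun h ↦ hτ (hinjR ((congrArg Subtype.val h).trans (map_zero _).symm))) (by
      obtain ⟨a, ha, ha'⟩ := hyτ
      have : algebraMap R V τ = ψV a := Subtype.ext ha'.symm
      rw [this]
      exact hm a ha)
  refine ⟨S.comp ψV, T, fun a ↦ (hST (ψV a)).symm, fun a ↦ ?_⟩
  have h := hS _ (hm (a - algebraMap K A (y a)) (by simp))
  rw [map_sub, map_sub, map_sub, sub_eq_zero] at h
  rw [AlgHom.comp_apply, h]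
  simp

/-! ### Lifting points, generic images and lines -/

/-- A point that is the image of some prime of `B` lifts to a `K`-point of `B`. -/
theorem exists_algHom_comp_eq {K A B : Type*} [Field K] [IsAlgClosed K]
    [CommRing A] [Algebra K A] [CommRing B] [Algebra K B] [Algebra.FiniteType K B]
    (φ : A →ₐ[K] B) (y : A →ₐ[K] K) (q : Ideal B) (hq : q ≠ ⊤)
    (hqy : RingHom.ker y ≤ q.comap φ) :
    ∃ β : B →ₐ[K] K, β.comp φ = y ∧ q ≤ RingHom.ker β := by
  obtain ⟨M, hM, hqM⟩ := Ideal.exists_le_maximal q hq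
  let _ : Field (B ⧸ M) := Ideal.Quotient.field M
  have : Module.Finite K (B ⧸ M) := finite_of_finite_type_of_isJacobsonRing K (B ⧸ M)
  have hb : Function.Bijective (algebraMap K (B ⧸ M)) :=
    IsAlgClosed.algebraMap_bijective_of_isIntegral
  let e := AlgEquiv.ofBijective (Algebra.ofId K (B ⧸ M)) hb
  refine ⟨e.symm.toAlgHom.comp (Ideal.Quotient.mkₐ K M), AlgHom.ext fun a ↦ ?_, fun b hb ↦ ?_⟩
  swap
  · change e.symm (Ideal.Quotient.mk M b) = 0
    rw [Ideal.Quotient.eq_zero_iff_mem.mpr (hqM hb), map_zero]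
  have h : Ideal.Quotient.mk M (φ (a - algebraMap K A (y a))) = 0 :=
    Ideal.Quotient.eq_zero_iff_mem.mpr (hqM (hqy (by simp [RingHom.mem_ker])))
  rw [map_sub, map_sub, sub_eq_zero, AlgHom.commutes] at h
  change e.symm (Ideal.Quotient.mk M (φ a)) = y a
  rw [h, AlgEquiv.symm_apply_eq]
  rfl

/-- A dominant morphism of finite type to an integral Noetherian affine scheme hits all points of
some nonempty open subset. -/
theorem exists_basicOpen_subset_range_comap {A B : Type*} [CommRing A] [IsDomain A]
    [IsNoetherianRing A] [CommRing B] [Nontrivial B] [Algebra A B] [FaithfulSMul A B]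
    [Algebra.FiniteType A B] :
    ∃ h : A, h ≠ 0 ∧ ((PrimeSpectrum.basicOpen h : Set (PrimeSpectrum A)) ⊆
      Set.range (PrimeSpectrum.comap (algebraMap A B))) := by
  have hfp : (algebraMap A B).FinitePresentation :=
    RingHom.finitePresentation_algebraMap.mpr (Algebra.FinitePresentation.of_finiteType.mp ‹_›)
  -- In an irreducible space a constructible set contains or misses a nonempty open set. The range
  -- contains the generic point, which excludes the second case.
  have key : ∀ s : Set (PrimeSpectrum A), Topology.IsConstructible s →
      ∃ h : A, h ≠ 0 ∧ ((PrimeSpectrum.basicOpen h : Set (PrimeSpectrum A)) ⊆ s ∨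
        (PrimeSpectrum.basicOpen h : Set (PrimeSpectrum A)) ⊆ sᶜ) := by
    intro s hs
    induction hs using Topology.IsConstructible.empty_union_induction with
    | open_retrocompact U hU hU' =>
      obtain rfl | ⟨x, hx⟩ := U.eq_empty_or_nonempty
      · exact ⟨1, one_ne_zero, by simp⟩
      · obtain ⟨_, ⟨h, rfl⟩, hxh, hhU⟩ :=
          PrimeSpectrum.isTopologicalBasis_basic_opens.exists_subset_of_mem_open hx hU
        exact ⟨h, fun h0 ↦ by simp [h0] at hxh, .inl hhU⟩
    | union s hs t ht ihs iht =>
      obtain ⟨h, h0, hh⟩ := ihs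
      obtain ⟨k, k0, hk⟩ := iht
      refine ⟨h * k, mul_ne_zero h0 k0, ?_⟩
      rw [PrimeSpectrum.basicOpen_mul, TopologicalSpace.Opens.coe_inf]
      grind
    | compl s hs ih =>
      obtain ⟨h, h0, hh⟩ := ih
      exact ⟨h, h0, by rw [compl_compl]; exact hh.symm⟩
  obtain ⟨h, h0, hh | hh⟩ := key _ (PrimeSpectrum.isConstructible_range_comap hfp)
  · exact ⟨h, h0, hh⟩
  · refine absurd (hh (show (⊥ : PrimeSpectrum A) ∈ _ by simpa using h0)) (not_not.mpr ?_)
    rw [PrimeSpectrum.mem_range_comap_iff]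
    simp [← RingHom.ker_eq_comap_bot, (RingHom.injective_iff_ker_eq_bot _).mp
      (FaithfulSMul.algebraMap_injective A B)]

/-- A nonzero algebra of finite type over a field maps to a finite field extension. -/
theorem exists_algHom_finite_field (k S : Type u) [Field k] [CommRing S] [Nontrivial S]
    [Algebra k S] [Algebra.FiniteType k S] :
    ∃ (L : Type u) (_ : Field L) (_ : Algebra k L), Module.Finite k L ∧ Nonempty (S →ₐ[k] L) := by
  obtain ⟨M, hM⟩ := Ideal.exists_maximal S
  let _ : Field (S ⧸ M) := Ideal.Quotient.field M
  exact ⟨S ⧸ M, inferInstance, inferInstance, finite_of_finite_type_of_isJacobsonRing k (S ⧸ M),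
    ⟨Ideal.Quotient.mkₐ k M⟩⟩

/-- The line through two points of affine space. -/
theorem exists_line {K σ : Type*} [Field K] (a b : σ → K) (hab : a ≠ b) :
    ∃ (θ : MvPolynomial σ K →ₐ[K] Polynomial K) (x : MvPolynomial σ K), θ x = Polynomial.X ∧
      (∀ g, (θ g).eval 0 = MvPolynomial.eval a g) ∧ ∀ g, (θ g).eval 1 = MvPolynomial.eval b g := by
  let θ : MvPolynomial σ K →ₐ[K] Polynomial K :=
    MvPolynomial.aeval fun i ↦ Polynomial.C (a i) + Polynomial.X * Polynomial.C (b i - a i)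
  have hθ (r : K) (g : MvPolynomial σ K) :
      (θ g).eval r = MvPolynomial.eval (fun i ↦ a i + r * (b i - a i)) g := by
    have : ((Polynomial.aeval r).comp θ) =
        MvPolynomial.aeval (R := K) fun i ↦ a i + r * (b i - a i) := by
      ext i; simp [θ]
    simpa [Polynomial.coe_aeval_eq_eval, MvPolynomial.coe_aeval_eq_eval] using
      congrArg (fun F ↦ F g) this
  obtain ⟨i, hi⟩ := Function.ne_iff.mp hab
  have hi' : b i - a i ≠ 0 := sub_ne_zero.mpr (Ne.symm hi)
  refine ⟨θ, (MvPolynomial.X i - MvPolynomial.C (a i)) * MvPolynomial.C (b i - a i)⁻¹, ?_, ?_, ?_⟩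
  · simp only [θ, map_mul, map_sub, MvPolynomial.aeval_X, MvPolynomial.algHom_C,
      Polynomial.algebraMap_eq]
    rw [add_sub_cancel_left, mul_assoc, ← map_sub, ← map_mul, mul_inv_cancel₀ hi', map_one,
      mul_one]
  · intro g; simp [hθ]
  · intro g; simp [hθ]

/-! ### Specialization along a curve and the valuative criterion -/

open scoped TensorProduct in
/-- Let `A ⊆ B` be domains of finite type over an algebraically closed field `K`, and `y` a
`K`-point of `A`. There is a `K((t))`-point of `B` whose image in `A` extends to a `K[[t]]`-point
specializing to `y`. -/
theorem exists_specialization_of_injective {K A B : Type u} [Field K] [IsAlgClosed K]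
    [CommRing A] [IsDomain A] [Algebra K A] [Algebra.FiniteType K A]
    [CommRing B] [Nontrivial B] [Algebra K B] [Algebra.FiniteType K B]
    [Algebra A B] [IsScalarTower K A B] [FaithfulSMul A B] (y : A →ₐ[K] K) :
    ∃ (α : A →ₐ[K] PowerSeries K) (β : B →ₐ[K] LaurentSeries K),
      (∀ a, inc K (α a) = β (algebraMap A B a)) ∧ ∀ a, PowerSeries.constantCoeff (α a) = y a := by
  -- If `y` lifts to `B`, constant arcs suffice.
  by_cases hq : ∃ q : Ideal B, q ≠ ⊤ ∧ RingHom.ker y ≤ q.comap (algebraMap A B)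
  · obtain ⟨q, hq, hqy⟩ := hq
    obtain ⟨β, hβ, -⟩ := exists_algHom_comp_eq (IsScalarTower.toAlgHom K A B) y q hq hqy
    refine ⟨(unit K).comp y, ((inc K).comp (unit K)).comp β, fun a ↦ ?_, fun a ↦ ?_⟩
    · rw [← hβ]; rfl
    · exact PowerSeries.constantCoeff_C _
  have : IsNoetherianRing A := Algebra.FiniteType.isNoetherianRing K A
  have : Algebra.FiniteType A B := .of_restrictScalars_finiteType K A B
  obtain ⟨h, h0, hh⟩ := exists_basicOpen_subset_range_comap (A := A) (B := B)
  have hhy : y h = 0 := by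
    by_contra hne
    have : (RingHom.ker y).IsPrime := RingHom.ker_isPrime y
    obtain ⟨q, hq'⟩ := hh (show (⟨RingHom.ker y, this⟩ : PrimeSpectrum A) ∈ _ from hne)
    exact hq ⟨q.asIdeal, q.2.ne_top, (congrArg PrimeSpectrum.asIdeal hq').ge⟩
  obtain ⟨s, g, ginj, gfin⟩ := exists_finite_inj_algHom_of_fg K A
  let P := MvPolynomial (Fin s) K
  let _ : Algebra P A := g.toRingHom.toAlgebra
  have : IsScalarTower K P A := .of_algebraMap_eq fun k ↦ (g.commutes k).symm
  have : Module.Finite P A := gfin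
  have : FaithfulSMul P A := (faithfulSMul_iff_algebraMap_injective P A).mpr ginj
  -- As `h` is integral over `P`, some nonzero multiple `c` of it lies in `P`. A line through the
  -- image of `y` on which `c` is not identically zero keeps the lifted curve outside `V(h)`.
  obtain ⟨c, hc, hc0⟩ := Submodule.exists_mem_ne_zero_of_ne_bot
    (Ideal.comap_ne_bot_of_integral_mem (R := P) h0 (Ideal.mem_span_singleton_self h)
      (Algebra.IsIntegral.isIntegral h))
  obtain ⟨d, hd⟩ := Ideal.mem_span_singleton.mp (Ideal.mem_comap.mp hc)
  let a (i : Fin s) : K := y (algebraMap P A (MvPolynomial.X i))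
  have ha (f : P) : y (algebraMap P A f) = MvPolynomial.eval a f := by
    have : y.comp (IsScalarTower.toAlgHom K P A) = MvPolynomial.aeval (R := K) a := by
      ext i; simp [a, P]
    rw [← MvPolynomial.coe_aeval_eq_eval, RingHom.coe_coe, ← this]
    rfl
  have hca : MvPolynomial.eval a c = 0 := by
    rw [← ha, hd, map_mul, hhy, zero_mul]
  obtain ⟨b, hb⟩ : ∃ b, MvPolynomial.eval b c ≠ 0 := by
    by_contra! H
    exact hc0 (MvPolynomial.funext fun b ↦ by rw [H, map_zero])
  obtain ⟨θ, x, hx, hθa, hθb⟩ := exists_line a b (by rintro rfl; exact hb hca)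
  let p : Ideal P := RingHom.ker θ
  have : (RingHom.ker y).IsPrime := RingHom.ker_isPrime y
  have : ((RingHom.ker y).under P).IsPrime := Ideal.IsPrime.under P _
  have : p.IsPrime := RingHom.ker_isPrime θ
  -- Going down for the finite extension `A` of the normal domain `P`: `p'` is the curve through `y`
  -- over the line.
  obtain ⟨p', hp'y, hp', hp'p⟩ := Ideal.exists_ideal_le_liesOver_of_le (p := p)
    (q := (RingHom.ker y).under P) (RingHom.ker y) (fun f hf ↦ by
      rw [RingHom.mem_ker] at hf
      rw [Ideal.mem_comap, RingHom.mem_ker, ha, ← hθa, hf, Polynomial.eval_zero])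
  have hpp' (f : P) : algebraMap P A f ∈ p' ↔ θ f = 0 := by
    rw [← RingHom.mem_ker]
    change _ ↔ f ∈ p
    rw [hp'p.over]
    rfl
  have hhp' : h ∉ p' := fun hmem ↦ hb (by
    rw [← hθb, (hpp' c).mp (hd ▸ p'.mul_mem_right d hmem), Polynomial.eval_zero])
  have : Nontrivial (p'.Fiber B) :=
    (PrimeSpectrum.nontrivial_iff_mem_rangeComap ⟨p', hp'⟩).mpr (hh hhp')
  obtain ⟨L, _, _, hL, ⟨ρ⟩⟩ := exists_algHom_finite_field p'.ResidueField (p'.Fiber B)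
  let _ := Localization.AtPrime.algebraOfLiesOver p p'
  let _ : Algebra A L := ((algebraMap p'.ResidueField L).comp
    (algebraMap A p'.ResidueField)).toAlgebra
  let _ : Algebra K L := ((algebraMap A L).comp (algebraMap K A)).toAlgebra
  let _ : Algebra p.ResidueField L := ((algebraMap p'.ResidueField L).comp
    (algebraMap p.ResidueField p'.ResidueField)).toAlgebra
  let _ : Algebra (P ⧸ p) L := ((algebraMap p.ResidueField L).comp
    (algebraMap (P ⧸ p) p.ResidueField)).toAlgebra
  have : IsScalarTower K A L := .of_algebraMap_eq fun _ ↦ rfl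
  have : IsScalarTower p.ResidueField p'.ResidueField L := .of_algebraMap_eq fun _ ↦ rfl
  have : IsScalarTower (P ⧸ p) p.ResidueField L := .of_algebraMap_eq fun _ ↦ rfl
  have : Module.Finite p.ResidueField L := .trans p'.ResidueField L
  have hPL (f : P) :
      algebraMap (P ⧸ p) L (Ideal.Quotient.mk p f) = algebraMap A L (algebraMap P A f) := by
    change algebraMap p'.ResidueField L (algebraMap p.ResidueField p'.ResidueField
      (algebraMap (P ⧸ p) p.ResidueField (algebraMap P (P ⧸ p) f))) =
      algebraMap p'.ResidueField L (algebraMap A p'.ResidueField (algebraMap P A f))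
    rw [← IsScalarTower.algebraMap_apply P (P ⧸ p) p.ResidueField,
      ← IsScalarTower.algebraMap_apply P A p'.ResidueField,
      ← IsScalarTower.algebraMap_apply P p.ResidueField p'.ResidueField]
  have : IsScalarTower K (P ⧸ p) L :=
      .of_algebraMap_eq fun k ↦ by
    refine Eq.trans ?_ (hPL (algebraMap K P k)).symm
    rw [← IsScalarTower.algebraMap_apply K P A, ← IsScalarTower.algebraMap_apply K A L]
  have hkerA (z : A) (hz : algebraMap A L z = 0) : z ∈ p' := by
    rwa [← p'.algebraMap_residueField_eq_zero, ← map_eq_zero (algebraMap p'.ResidueField L)]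
  let ε : (P ⧸ p) →ₐ[K] K := Ideal.Quotient.liftₐ p (MvPolynomial.aeval a) fun f hf ↦ by
    rw [RingHom.mem_ker] at hf
    rw [MvPolynomial.aeval_eq_eval, ← hθa, hf, Polynomial.eval_zero]
  have hε (f : P) : ε (Ideal.Quotient.mk p f) = (θ f).eval 0 := by
    rw [hθa, ← MvPolynomial.coe_aeval_eq_eval]
    rfl
  -- `θ` identifies `P ⧸ p` with `K[X]` and `x` with the variable, so divisibility can be tested on
  -- polynomials.
  have hdvd (f : P) (n : ℕ) :
      Ideal.Quotient.mk p x ^ n ∣ Ideal.Quotient.mk p f ↔ Polynomial.X ^ n ∣ θ f := by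
    constructor
    · rintro ⟨r, hr⟩
      obtain ⟨e, rfl⟩ := Ideal.Quotient.mk_surjective r
      rw [← map_pow, ← map_mul, Ideal.Quotient.mk_eq_mk_iff_sub_mem, RingHom.mem_ker, map_sub,
        sub_eq_zero, map_mul, map_pow, hx] at hr
      exact ⟨_, hr⟩
    · rintro ⟨e, he⟩
      refine ⟨Ideal.Quotient.mk p (Polynomial.aeval x e), ?_⟩
      rw [← map_pow, ← map_mul, Ideal.Quotient.mk_eq_mk_iff_sub_mem, RingHom.mem_ker, map_sub,
        sub_eq_zero, map_mul, map_pow, hx, ← Polynomial.aeval_algHom_apply, hx, he,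
        Polynomial.aeval_X_left_apply]
  have hmk (f : P) : Ideal.Quotient.mk p f = 0 ↔ θ f = 0 := by
    rw [Ideal.Quotient.eq_zero_iff_mem, RingHom.mem_ker]
  obtain ⟨α, T, hαT, hαy⟩ := exists_laurentSeries_specialization (F := p.ResidueField) ε
    (Ideal.Quotient.mk p x) (by rw [Ne, hmk, hx]; exact Polynomial.X_ne_zero)
    (fun r hr ↦ by
      obtain ⟨f, rfl⟩ := Ideal.Quotient.mk_surjective r
      rw [hε, ← Polynomial.coeff_zero_eq_eval_zero, ← Polynomial.X_dvd_iff] at hr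
      simpa using (hdvd f 1).mpr (by simpa using hr))
    (fun r hr ↦ by
      obtain ⟨f, rfl⟩ := Ideal.Quotient.mk_surjective r
      rw [hmk]
      ext n
      exact Polynomial.X_pow_dvd_iff.mp ((hdvd f (n + 1)).mp (hr _)) n n.lt_succ_self)
    (IsScalarTower.toAlgHom K A L) y (fun z hz ↦ hp'y (hkerA z hz))
    (fun r ↦ by
      obtain ⟨f, rfl⟩ := Ideal.Quotient.mk_surjective r
      exact ⟨algebraMap P A f, (hPL f).symm⟩)
    ⟨algebraMap P A x, by rw [ha, ← hθa, hx, Polynomial.eval_X], (hPL x).symm⟩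
  have hρ (z : A) : ρ (1 ⊗ₜ[A] algebraMap A B z) = algebraMap A L z := by
    rw [← mul_one (algebraMap A B z), ← Algebra.smul_def, ← TensorProduct.smul_tmul,
      ← Algebra.algebraMap_eq_smul_one]
    exact ρ.commutes (algebraMap A p'.ResidueField z)
  let ρB : B →ₐ[K] L :=
    { (ρ : p'.Fiber B →+* L).comp
        (Algebra.TensorProduct.includeRight : B →ₐ[A] p'.Fiber B).toRingHom with
      commutes' := fun k ↦ by
        change ρ (1 ⊗ₜ[A] algebraMap K B k) = _
        rw [IsScalarTower.algebraMap_apply K A B, hρ, ← IsScalarTower.algebraMap_apply K A L] }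
  exact ⟨α, T.comp ρB, fun z ↦ (hαT z).trans (congrArg T (hρ z).symm), hαy⟩

/-- Valuative criterion for the closure of the image of a morphism `Spec H → Spec R` of affine
schemes of finite type over an algebraically closed field. -/
theorem mem_closure_image_iff_exists_powerSeries {K R H : Type u} [Field K] [IsAlgClosed K]
    [CommRing R] [Algebra K R] [Algebra.FiniteType K R]
    [CommRing H] [Algebra K H] [Algebra.FiniteType K H] (φ : R →ₐ[K] H) (y : R →ₐ[K] K) :
    (∀ r, (∀ g : H →ₐ[K] K, g (φ r) = 0) → y r = 0) ↔
      ∃ (α : R →ₐ[K] PowerSeries K) (g : H →ₐ[K] LaurentSeries K),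
        (inc K).comp α = g.comp φ ∧ (proj K).comp α = y := by
  constructor
  · intro hy
    have : IsNoetherianRing H := Algebra.FiniteType.isNoetherianRing K H
    -- Otherwise each minimal prime yields an `r q` with `φ (r q) ∈ q` and `y (r q) ≠ 0`; their
    -- product has nilpotent image in `H`, so `y` kills it.
    obtain ⟨q, hq, hqy⟩ : ∃ q ∈ minimalPrimes H, q.comap φ ≤ RingHom.ker y := by
      by_contra! hcon
      have hfin : (minimalPrimes H).Finite := minimalPrimes.finite_of_isNoetherianRing H
      choose! r hr hry using fun q hq ↦ SetLike.not_le_iff_exists.mp (hcon q hq)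
      have hmem : φ (∏ q ∈ hfin.toFinset, r q) ∈ nilradical H := by
        rw [nilradical, ← Ideal.sInf_minimalPrimes, Ideal.mem_sInf]
        intro q hq
        exact Ideal.mem_comap.mp (Ideal.mem_of_dvd _
          (Finset.dvd_prod_of_mem r (hfin.mem_toFinset.mpr hq)) (hr q hq))
      have hnil : IsNilpotent (φ (∏ q ∈ hfin.toFinset, r q)) := hmem
      have h0 := hy _ fun g ↦ (hnil.map g).eq_zero
      rw [map_prod, Finset.prod_eq_zero_iff] at h0
      obtain ⟨q, hq, hq0⟩ := h0
      exact hry q (hfin.mem_toFinset.mp hq) hq0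
    have : q.IsPrime := hq.1.1
    let p := q.comap φ
    have : p.IsPrime := inferInstance
    let φ' : (R ⧸ p) →ₐ[K] (H ⧸ q) := Ideal.quotientMapₐ q φ le_rfl
    have hinj : Function.Injective φ' := Ideal.quotientMap_injective
    let _ : Algebra (R ⧸ p) (H ⧸ q) := φ'.toRingHom.toAlgebra
    have : IsScalarTower K (R ⧸ p) (H ⧸ q) := .of_algebraMap_eq fun k ↦ (φ'.commutes k).symm
    have : FaithfulSMul (R ⧸ p) (H ⧸ q) := (faithfulSMul_iff_algebraMap_injective _ _).mpr hinj
    obtain ⟨α, β, hαβ, hαy⟩ := exists_specialization_of_injective (A := R ⧸ p) (B := H ⧸ q)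
      (Ideal.Quotient.liftₐ p y fun a ha ↦ hqy ha)
    exact ⟨α.comp (Ideal.Quotient.mkₐ K p), β.comp (Ideal.Quotient.mkₐ K q),
      AlgHom.ext fun a ↦ hαβ _, AlgHom.ext fun a ↦ hαy _⟩
  · rintro ⟨α, g, hαg, rfl⟩ r hr
    have : IsJacobsonRing H := isJacobsonRing_of_finiteType (A := K)
    -- Nullstellensatz: every maximal ideal of `H` is the kernel of a `K`-point.
    have hnil : IsNilpotent (φ r) := by
      rw [← mem_nilradical, nilradical, Ideal.radical_eq_jacobson, Ideal.jacobson, Ideal.mem_sInf]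
      rintro M ⟨-, hM⟩
      obtain ⟨g, -, hg⟩ := exists_algHom_comp_eq (Algebra.ofId K H) (AlgHom.id K K) M hM.ne_top
        fun k hk ↦ by
          rw [RingHom.mem_ker, AlgHom.id_apply] at hk
          rw [hk]; exact zero_mem _
      rw [hM.eq_of_le (RingHom.ker_ne_top g) hg]
      exact hr g
    have h0 : inc K (α r) = 0 := by
      have : inc K (α r) = g (φ r) := congrArg (fun F ↦ F r) hαg
      rw [this]
      exact (hnil.map g).eq_zero
    have h1 : α r = 0 := HahnSeries.ofPowerSeries_injective (h0.trans (map_zero _).symm)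
    rw [AlgHom.comp_apply, h1, map_zero]

/-! ### Algebra homomorphisms as points of affine schemes -/

section Spec

variable {K : Type u} [Field K] {A B C : Type u} [CommRing A] [Algebra K A] [CommRing B]
  [Algebra K B] [CommRing C] [Algebra K C]

theorem specMap_comp (f : A →ₐ[K] B) (g : B →ₐ[K] C) :
    specMap g ≫ specMap f = specMap (g.comp f) := by
  ext1
  change Spec.map _ ≫ Spec.map _ = Spec.map _
  rw [← Spec.map_comp, ← CommRingCat.ofHom_comp]
  rfl

theorem specMap_id : specMap (AlgHom.id K A) = 𝟙 (spec K A) := by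
  ext1
  exact Spec.map_id _

theorem specMap_injective : Function.Injective (specMap : (A →ₐ[K] B) → (spec K B ⟶ spec K A)) := by
  intro f g h
  have h' : Spec.map (CommRingCat.ofHom f.toRingHom) = Spec.map (CommRingCat.ofHom g.toRingHom) :=
    congrArg CommaMorphism.left h
  ext a
  exact congrArg (fun F ↦ F.hom a) (Spec.map_injective h')

theorem specMap_surjective :
    Function.Surjective (specMap : (A →ₐ[K] B) → (spec K B ⟶ spec K A)) := by
  intro f
  obtain ⟨φ, hφ⟩ := Spec.map_surjective f.left
  have hw : CommRingCat.ofHom (algebraMap K A) ≫ φ = CommRingCat.ofHom (algebraMap K B) := by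
    apply Spec.map_injective
    rw [Spec.map_comp, hφ]
    exact Over.w f
  refine ⟨⟨φ.hom, fun k ↦ congrArg (fun F ↦ F.hom k) hw⟩, ?_⟩
  ext1
  exact hφ

/-- The structure morphism of `spec K K` is an isomorphism. This makes constant morphisms stable
under pullback. -/
theorem subsingleton_hom_spec_self (Y : Over (Spec (CommRingCat.of K))) :
    Subsingleton (Y ⟶ spec K K) := by
  refine ⟨fun f g ↦ ?_⟩
  ext1
  have : IsIso (spec K K).hom := by
    exact inferInstanceAs (IsIso (Spec.map (𝟙 (CommRingCat.of K))))
  rw [← cancel_mono (spec K K).hom, Over.w, Over.w]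

/-- The structure morphism of a scheme over `K`, with target `Spec K` viewed as a scheme over
`K`. -/
noncomputable def toSpecSelf (Y : Over (Spec (CommRingCat.of K))) : Y ⟶ spec K K :=
  Over.homMk Y.hom (by
    change Y.hom ≫ Spec.map (CommRingCat.ofHom (RingHom.id K)) = Y.hom
    rw [show CommRingCat.ofHom (RingHom.id K) = 𝟙 _ from rfl, Spec.map_id, Category.comp_id])

theorem exists_iso_spec (X : Over (Spec (CommRingCat.of K))) [IsAffine X.left]
    [LocallyOfFiniteType X.hom] :
    ∃ (R : Type u) (_ : CommRing R) (_ : Algebra K R), Algebra.FiniteType K R ∧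
      Nonempty (X ≅ spec K R) := by
  obtain ⟨φ, hφ⟩ := Spec.map_surjective (X.left.isoSpec.inv ≫ X.hom)
  let _ : Algebra K Γ(X.left, ⊤) := φ.hom.toAlgebra
  refine ⟨Γ(X.left, ⊤), inferInstance, inferInstance, ?_, ⟨Over.isoMk X.left.isoSpec ?_⟩⟩
  · have : LocallyOfFiniteType (Spec.map φ) := hφ ▸ inferInstance
    exact (HasRingHomProperty.Spec_iff (P := @LocallyOfFiniteType)).mp this
  · change X.left.isoSpec.hom ≫ Spec.map φ = X.hom
    rw [hφ, Iso.hom_inv_id_assoc]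

/-- Membership in the Zariski closure of a set of `K`-points of an affine scheme, in terms of the
regular functions that vanish on the set. -/
theorem specMap_comp_mem_closure_iff {X : Over (Spec (CommRingCat.of K))} (e : X ≅ spec K A)
    (s : Set (Points X K)) (y : A →ₐ[K] K) :
    specMap y ≫ e.inv ∈ @closure _ (zariskiTopology X) s ↔
      ∀ r, (∀ z : A →ₐ[K] K, specMap z ≫ e.inv ∈ s → z r = 0) → y r = 0 := by
  let e' := (Over.forget _).mapIso e
  let h : X.left ≃ₜ PrimeSpectrum A := e'.hom.homeomorph
  -- The prime attached to a `K`-point is its kernel.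
  have hpt (z : A →ₐ[K] K) (r : A) :
      r ∈ (h (Points.toPoint (specMap z ≫ e.inv))).asIdeal ↔ z r = 0 := by
    have : h (Points.toPoint (specMap z ≫ e.inv)) =
        PrimeSpectrum.comap z.toRingHom (IsLocalRing.closedPoint K) := by
      have hz : (specMap z ≫ e.inv).left ≫ e.hom.left = (specMap z).left := by
        rw [← Over.comp_left, Category.assoc, e.inv_hom_id, Category.comp_id]
      exact congrArg (fun F ↦ F (IsLocalRing.closedPoint K : PrimeSpectrum K)) hz
    rw [this]
    change z r ∈ IsLocalRing.maximalIdeal K ↔ _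
    simp
  rw [closure_induced, ← h.injective.mem_set_image, h.image_closure,
    ← PrimeSpectrum.zeroLocus_vanishingIdeal_eq_closure, PrimeSpectrum.mem_zeroLocus]
  refine forall_congr' fun r ↦ ?_
  rw [SetLike.mem_coe, SetLike.mem_coe, hpt, PrimeSpectrum.mem_vanishingIdeal]
  refine imp_congr_left ⟨fun H z hz ↦ (hpt z r).mp (H _ ⟨_, ⟨_, hz, rfl⟩, rfl⟩), ?_⟩
  rintro H _ ⟨_, ⟨z, hz, rfl⟩, rfl⟩
  obtain ⟨z', hz'⟩ := specMap_surjective (z ≫ e.hom)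
  obtain rfl : specMap z' ≫ e.inv = z := by rw [hz', Category.assoc, e.hom_inv_id, Category.comp_id]
  exact (hpt z' r).mpr (H z' hz)

end Spec

/-! ### Orbit maps and translations -/

section Action

variable {K : Type u} [Field K] {G X : Over (Spec (CommRingCat.of K))} [GrpObj G] [ModObj G X]

/-- The `K`-point `x` as a morphism `Y ⟶ X`, for every scheme `Y` over `K`. -/
noncomputable def constHom (Y : Over (Spec (CommRingCat.of K))) (x : Points X K) : Y ⟶ X :=
  toSpecSelf Y ≫ x

theorem comp_constHom {Y Z : Over (Spec (CommRingCat.of K))} (f : Z ⟶ Y) (x : Points X K) :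
    f ≫ constHom Y x = constHom Z x := by
  rw [constHom, ← Category.assoc, (subsingleton_hom_spec_self Z).elim (f ≫ toSpecSelf Y)
    (toSpecSelf Z)]
  rfl

theorem constHom_spec {A : Type u} [CommRing A] [Algebra K A] (f : K →ₐ[K] A) (x : Points X K) :
    constHom (spec K A) x = specMap f ≫ x := by
  rw [constHom, (subsingleton_hom_spec_self _).elim (toSpecSelf _) (specMap f)]

theorem constHom_self (x : Points X K) : constHom (spec K K) x = x := by
  rw [constHom_spec (AlgHom.id K K), specMap_id, Category.id_comp]

variable (G) in
/-- The orbit map `g ↦ g • x`. -/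
noncomputable def orbitMap (x : Points X K) : G ⟶ X :=
  𝟙 G • constHom G x

/-- Naturality of the action lets one morphism compute `g • x` over `K` and over `K((t))` alike. -/
theorem comp_orbitMap {Y : Over (Spec (CommRingCat.of K))} (g : Y ⟶ G) (x : Points X K) :
    g ≫ orbitMap G x = g • constHom Y x := by
  rw [orbitMap, ModObj.comp_smul, Category.comp_id, comp_constHom]

theorem continuous_comp {X Y : Over (Spec (CommRingCat.of K))} (f : X ⟶ Y) :
    @Continuous _ _ (zariskiTopology X) (zariskiTopology Y) fun z : Points X K ↦ z ≫ f := by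
  let _ := zariskiTopology X
  refine continuous_induced_rng.mpr ?_
  exact f.left.continuous.comp continuous_induced_dom

/-- Translation by `g` is induced by a morphism `X ⟶ X`, the constant `g` acting on the identity. -/
theorem continuous_smul (g : Points G K) :
    @Continuous _ _ (zariskiTopology X) (zariskiTopology X) fun z : Points X K ↦ g • z := by
  have h (z : Points X K) : z ≫ (constHom X g • 𝟙 X) = g • z := by
    rw [ModObj.comp_smul, comp_constHom, constHom_self, Category.comp_id]
  simpa only [h] using continuous_comp (constHom X g • 𝟙 X)

open scoped MonObj in
theorem orbit_subset_closure_orbit_iff (x y : Points X K) :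
    MulAction.orbit (Points G K) y ⊆
        @closure _ (zariskiTopology X) (MulAction.orbit (Points G K) x) ↔
      y ∈ @closure _ (zariskiTopology X) (MulAction.orbit (Points G K) x) := by
  let _ := zariskiTopology X
  refine ⟨fun h ↦ h ⟨1, one_smul (Points G K) y⟩, ?_⟩
  rintro hy _ ⟨g, rfl⟩
  refine map_mem_closure (continuous_smul g) hy ?_
  rintro _ ⟨g', rfl⟩
  exact ⟨g * g', mul_smul g g' x⟩

end Action

end OrbitClosure

/-! ### The orbit closure criterion in coordinate rings -/

theorem theorem2p2 {K : Type u} [Field K] [IsAlgClosed K]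
    (G X : Over (Spec (CommRingCat.of K)))
    [IsAffine G.left] [LocallyOfFiniteType G.hom] [GrpObj G]
    [IsAffine X.left] [LocallyOfFiniteType X.hom] [ModObj G X]
    (x y : OrbitClosure.Points X K) :
    MulAction.orbit (OrbitClosure.Points G K) y ⊆
        @closure _ (OrbitClosure.zariskiTopology X)
          (MulAction.orbit (OrbitClosure.Points G K) x) ↔
      ∃ 𝔛 : OrbitClosure.Points X (PowerSeries K),
        (∃ g : OrbitClosure.Points G (LaurentSeries K),
          OrbitClosure.Points.map X (OrbitClosure.inc K) 𝔛 =
            g • OrbitClosure.Points.map X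
              ((OrbitClosure.inc K).comp (OrbitClosure.unit K)) x) ∧
        OrbitClosure.Points.map X (OrbitClosure.proj K) 𝔛 = y := by
  open OrbitClosure in
  obtain ⟨R, _, _, _, ⟨eX⟩⟩ := exists_iso_spec X
  obtain ⟨H, _, _, _, ⟨eG⟩⟩ := exists_iso_spec G
  obtain ⟨φ, hφ⟩ := specMap_surjective (eG.inv ≫ orbitMap G x ≫ eX.hom)
  have hsurj {A : Type u} [CommRing A] [Algebra K A] {S : Type u} [CommRing S] [Algebra K S]
      {Y : Over (Spec (CommRingCat.of K))} (e : Y ≅ spec K S) (z : Points Y A) :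
      ∃ f : S →ₐ[K] A, specMap f ≫ e.inv = z := by
    obtain ⟨f, hf⟩ := specMap_surjective (z ≫ e.hom)
    exact ⟨f, by rw [hf, Category.assoc, e.hom_inv_id, Category.comp_id]⟩
  have hact {A : Type u} [CommRing A] [Algebra K A] (g : H →ₐ[K] A) :
      (specMap g ≫ eG.inv) • constHom (spec K A) x = specMap (g.comp φ) ≫ eX.inv := by
    rw [← comp_orbitMap, ← specMap_comp, hφ]
    simp
  have hcancel {A : Type u} [CommRing A] [Algebra K A] (f f' : R →ₐ[K] A) :
      specMap f ≫ eX.inv = specMap f' ≫ eX.inv ↔ f = f' := by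
    rw [cancel_mono, specMap_injective.eq_iff]
  obtain ⟨y, rfl⟩ := hsurj eX y
  rw [orbit_subset_closure_orbit_iff, specMap_comp_mem_closure_iff]
  have horb (z : R →ₐ[K] K) :
      specMap z ≫ eX.inv ∈ MulAction.orbit (Points G K) x ↔ ∃ g : H →ₐ[K] K, z = g.comp φ := by
    constructor
    · rintro ⟨g, hg⟩
      obtain ⟨g, rfl⟩ := hsurj eG g
      refine ⟨g, (hcancel _ _).mp ?_⟩
      rw [← hact, constHom_self]
      exact hg.symm
    · rintro ⟨g, rfl⟩
      exact ⟨specMap g ≫ eG.inv, by rw [← hact, constHom_self]⟩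
  have hvan (r : R) : (∀ z : R →ₐ[K] K, specMap z ≫ eX.inv ∈ MulAction.orbit (Points G K) x →
      z r = 0) ↔ ∀ g : H →ₐ[K] K, g (φ r) = 0 := by
    simp only [horb]
    exact ⟨fun h g ↦ h _ ⟨g, rfl⟩, by rintro h _ ⟨g, rfl⟩; exact h g⟩
  simp only [hvan]
  rw [mem_closure_image_iff_exists_powerSeries]
  constructor
  · rintro ⟨α, g, h1, h2⟩
    refine ⟨specMap α ≫ eX.inv, ⟨specMap g ≫ eG.inv, ?_⟩, ?_⟩
    · rw [Points.map, Points.map, ← constHom_spec, hact, ← Category.assoc, specMap_comp, h1]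
    · rw [Points.map, ← Category.assoc, specMap_comp, h2]
  · rintro ⟨𝔛, ⟨g, h1⟩, h2⟩
    obtain ⟨α, rfl⟩ := hsurj eX 𝔛
    obtain ⟨g, rfl⟩ := hsurj eG g
    refine ⟨α, g, (hcancel _ _).mp ?_, (hcancel _ _).mp ?_⟩
    · rw [← hact, constHom_spec ((inc K).comp (unit K)), ← specMap_comp, Category.assoc]
      exact h1
    · rw [← specMap_comp, Category.assoc]
      exact h2
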